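/- Let $q>2$ be a prime power, let $n\ge 1$, let $k\ge 1$ be a divisor of $n$, and let $\mathbb F_q\subseteq\mathbb F_{q^k}\subseteq\mathbb F_{q^n}$. Let $\ell_\infty$ be the line $c=0$ of $\mathrm{PG}(2,q^n)$. Take $\mathbb F_{q^n}\times\mathbb F_{q^n}\times\mathbb F_q$ as the underlying $\mathbb F_q$-vector space of $\mathrm{PG}(2n,q)$, and let $H_\infty\simeq\mathrm{PG}(2n-1,q)$ be its hyperplane $c=0$. For each divisor $d$ of $n$ let $$\mathcal D_d=\bigl\{\{(ax,bx,0)_{\mathbb F_q} : x\in\mathbb F_{q^d}^*\} : a,b\in\mathbb F_{q^n},\ (a,b)\neq(0,0)\bigr\},$$ a Desarguesian $(d-1)$-spread of $H_\infty$, and put $\mathcal D=\mathcal D_n$. The André/Bruck–Bose map $\phi$ sends the point $(a,b,1)_{\mathbb F_{q^n}}$ to the point $(a,b,1)_{\mathbb F_q}$ and the point $(a,b,0)_{\mathbb F_{q^n}}$ of $\ell_\infty$ to the element $\{(ax,bx,0)_{\mathbb F_q}: x\in\mathbb F_{q^n}^*\}$ of $\mathcal D$. An $\mathbb F_{q^k}$-subline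 is a set $\{(su+tv)_{\mathbb F_{q^n}} : s,t\in\mathbb F_{q^k},\ (s,t)\ne(0,0)\}$ with $u,v\in\mathbb F_{q^n}^3$ linearly independent over $\mathbb F_{q^n}$. A regulus is a set of $q+1$ pairwise disjoint $(n-1)$-spaces contained in a $(2n-1)$-space such that every line meeting three of them meets all of them. All dimensions of subspaces below are projective. Then any three distinct elements of $\mathcal D$ lie in a unique regulus. Moreover, if $\mathcal S$ is a set of $q^k+1$ elements of $\mathcal D$, the following are equivalent: 1. $\mathcal S$ is the image under $\phi$ of an $\mathbb F_{q^k}$-subline contained in $\ell_\infty$; 2. for any three distinct elements of $\mathcal S$, the unique regulus through them is contained in $\mathcal S$; 3. there is a $(2k-1)$-dimensional subspace of $H_\infty$ that meets each element of $\mathcal S$ in a $(k-1)$-dimensional space; 4. there is a $(2k-1)$-dimensional subspace of $H_\infty$ that meets each element of $\mathcal S$ in an element of $\mathcal D_k$. -/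

import Mathlib

open scoped LinearAlgebra.Projectivization

/-!  Projective spaces are handled through their underlying vector spaces: a subspace of projective
dimension `d` is a linear subspace of (vector space) dimension `d + 1`, and two subspaces meet when
their linear intersection is nonzero.  `F` plays the role of the field with `q` elements and `K`
that of its extension of degree `n`. -/

namespace ABB

section Regulus

variable (F : Type*) [Field F] {V : Type*} [AddCommGroup V] [Module F V]

/-- A regulus of `(n - 1)`-spaces: a set of `q + 1` pairwise disjoint `(n - 1)`-spaces contained in
a `(2 n - 1)`-space, such that every line that meets three of them meets all of them. -/
structure IsRegulus (n : ℕ) (R : Set (Submodule F V)) : Prop where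
  ncard_eq : R.ncard = Nat.card F + 1
  finrank_eq : ∀ A ∈ R, Module.finrank F A = n
  pairwise_disjoint : ∀ A ∈ R, ∀ B ∈ R, A ≠ B → A ⊓ B = ⊥
  ambient : ∃ W : Submodule F V, Module.finrank F W = 2 * n ∧ ∀ A ∈ R, A ≤ W
  transversal : ∀ l : Submodule F V, Module.finrank F l = 2 →
    (∃ A ∈ R, ∃ B ∈ R, ∃ C ∈ R, A ≠ B ∧ A ≠ C ∧ B ≠ C ∧
      A ⊓ l ≠ ⊥ ∧ B ⊓ l ≠ ⊥ ∧ C ⊓ l ≠ ⊥) →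
    ∀ A ∈ R, A ⊓ l ≠ ⊥

/-- `R` is a regulus of `(n - 1)`-spaces having `A`, `B`, `C` among its elements. -/
def IsRegulusThrough (n : ℕ) (A B C : Submodule F V) (R : Set (Submodule F V)) : Prop :=
  IsRegulus F n R ∧ A ∈ R ∧ B ∈ R ∧ C ∈ R

end Regulus

variable (F K : Type*) [Field F] [Field K] [Algebra F K]

/-- The line at infinity of `PG(2, q^n)`, with equation `c = 0`. -/
def lineInfinity : Set (ℙ K (K × K × K)) :=
  {P | ∀ v ∈ P.submodule, v.2.2 = 0}

/-- The hyperplane `c = 0` of `PG(2 n, q)`, whose underlying vector space is `K × K × F`. -/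
def hyperplaneInfinity : Submodule F (K × K × F) where
  carrier := {v | v.2.2 = 0}
  add_mem' := by
    intro v w hv hw
    simp only [Set.mem_ofPred_eq] at hv hw ⊢
    simp [hv, hw]
  zero_mem' := rfl
  smul_mem' := by
    intro c v hv
    simp only [Set.mem_ofPred_eq] at hv ⊢
    simp [hv]

/-- The `F`-linear inclusion of `K × K × F` into `K × K × K`. -/
def inclusion : (K × K × F) →ₗ[F] (K × K × K) :=
  LinearMap.prodMap LinearMap.id (LinearMap.prodMap LinearMap.id (Algebra.linearMap F K))

variable {K}

/-- The ABB-map from points of `PG(2, q^n)` to subspaces of `PG(2 n, q)`: the point `P` goes to the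
space of all `(a, b, c)`, `c` in `F`, that lie in the `K`-line `P`.  Hence `(a, b, 1)` goes
to the point `(a, b, 1)` and `(a, b, 0)` goes to the `(n - 1)`-space of all `(a x, b x, 0)`; see
`abbMap_affine` and `abbMap_infinite`. -/
def abbMap (P : ℙ K (K × K × K)) : Submodule F (K × K × F) :=
  (P.submodule.restrictScalars F).comap (inclusion F K)

variable {F}

/-- The subspace `{(a x, b x, 0) | x ∈ E}` of `K × K × F`. -/
def spreadElement (E : IntermediateField F K) (a b : K) : Submodule F (K × K × F) where
  carrier := {v | ∃ x ∈ E, v = (a * x, b * x, 0)}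
  add_mem' := by
    rintro _ _ ⟨x, hx, rfl⟩ ⟨y, hy, rfl⟩
    exact ⟨x + y, E.add_mem hx hy, by simp [mul_add]⟩
  zero_mem' := ⟨0, E.zero_mem, by simp; rfl⟩
  smul_mem' := by
    rintro c _ ⟨x, hx, rfl⟩
    exact ⟨c • x, E.smul_mem hx, by simp⟩

/-- The Desarguesian spread `D_k` of the hyperplane at infinity, where `E` is the subfield of `K`
with `q^k` elements: all spaces `{(a x, b x, 0) | x ∈ E}` with `a`, `b` in `K`, not both zero. -/
def subspread (E : IntermediateField F K) : Set (Submodule F (K × K × F)) :=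
  {A | ∃ a b : K, (a, b) ≠ (0, 0) ∧ A = spreadElement E a b}

variable (F K) in
/-- The Desarguesian spread `D` of the hyperplane at infinity: all `(n - 1)`-spaces
`{(a x, b x, 0) | x ∈ K}` with `a`, `b` in `K`, not both zero. -/
def desarguesianSpread : Set (Submodule F (K × K × F)) :=
  subspread (⊤ : IntermediateField F K)

/-- An `E`-subline of `PG(2, q^n)`: the points of a line whose coordinates, with respect to a
suitable frame of that line, can be taken in `E`. -/
def IsSubline (E : IntermediateField F K) (m : Set (ℙ K (K × K × K))) : Prop :=
  ∃ u v : K × K × K, LinearIndependent K ![u, v] ∧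
    m = {P | ∃ s ∈ E, ∃ t ∈ E, ∃ h : s • u + t • v ≠ 0, P = Projectivization.mk K (s • u + t • v) h}

theorem abbMap_affine (a b : K) (h : ((a, b, 1) : K × K × K) ≠ 0) :
    abbMap F (Projectivization.mk K (a, b, 1) h) = Submodule.span F {(a, b, (1 : F))} := by
  ext ⟨x, y, c⟩
  simp only [abbMap, inclusion, Submodule.mem_comap, Submodule.restrictScalars_mem,
    Projectivization.submodule_mk, Submodule.mem_span_singleton, LinearMap.prodMap_apply,
    LinearMap.id_apply, Algebra.linearMap_apply, Prod.smul_mk, Prod.mk.injEq, smul_eq_mul, mul_one]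
  constructor
  · rintro ⟨r, rfl, rfl, rfl⟩
    exact ⟨c, by simp [Algebra.smul_def], by simp [Algebra.smul_def], rfl⟩
  · rintro ⟨r, rfl, rfl, rfl⟩
    exact ⟨algebraMap F K r, by simp [Algebra.smul_def], by simp [Algebra.smul_def], rfl⟩

theorem abbMap_infinite (a b : K) (h : ((a, b, 0) : K × K × K) ≠ 0) :
    abbMap F (Projectivization.mk K (a, b, 0) h) = spreadElement ⊤ a b := by
  ext ⟨x, y, c⟩
  simp only [abbMap, inclusion, Submodule.mem_comap, Submodule.restrictScalars_mem,
    Projectivization.submodule_mk, Submodule.mem_span_singleton, LinearMap.prodMap_apply,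
    LinearMap.id_apply, Algebra.linearMap_apply, Prod.smul_mk, Prod.mk.injEq, smul_eq_mul, mul_zero]
  constructor
  · rintro ⟨r, rfl, rfl, h0⟩
    have hc : c = 0 := (map_eq_zero (algebraMap F K)).1 h0.symm
    exact ⟨r, trivial, by simp [hc, mul_comm]⟩
  · rintro ⟨r, -, hr⟩
    simp only [Prod.mk.injEq] at hr
    obtain ⟨rfl, rfl, rfl⟩ := hr
    exact ⟨r, mul_comm _ _, mul_comm _ _, by simp⟩

end ABB

/-!
If `α β : L →ₗ[F] V` are such that `α.coprod β` is injective, the only regulus through the ranges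
of `α`, `β` and `α + β` is the pencil of ranges of the nonzero combinations of `α` and `β`: a
further member of a regulus is the range of some `α + β ∘ g`, and the transversal lines spanned by
`α x` and `β x` make every vector `x` an eigenvector of `g`.

For (3) ⇒ (2), the traces of the members of `S` on `W` are `q ^ k + 1` pairwise disjoint
`(k - 1)`-spaces, so they cover `W`. Every member of a regulus through three members of `S` meets
`W`, because the regulus restricts to `W`, so it meets, and therefore equals, a member of `S`.

For (2) ⇒ (1), choose a frame `u`, `v` of the line at infinity such that the spread elements
through `u`, `v` and `u + v` are in `S`. Closure under reguli says that the set `T` of affine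
coordinates of `S` is closed under affine combinations over `F`; as `F` has more than two elements,
`T` is an `F`-subspace. Exchanging `u` and `v` shows the same for the inverses of `T`, so by Hua's
identity `T` is a subfield. It has `q ^ k` elements and so equals `E`.
-/

namespace ABB

section LinearAlgebra

variable {F M : Type*} [Field F] [AddCommGroup M] [Module F M]

theorem exists_smul_add_smul_eq_of_mem_span_pair {a b c : M} (hc : c ∈ Submodule.span F {a, b})
    (hac : LinearIndependent F ![a, c]) (hbc : LinearIndependent F ![b, c]) :
    ∃ s t : F, s ≠ 0 ∧ t ≠ 0 ∧ s • a + t • b = c := by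
  obtain ⟨s, t, rfl⟩ := Submodule.mem_span_pair.1 hc
  refine ⟨s, t, ?_, ?_, rfl⟩
  · rintro rfl
    simpa using (LinearIndependent.pair_iff.1 hbc t (-1) (by simp)).2
  · rintro rfl
    simpa using (LinearIndependent.pair_iff.1 hac s (-1) (by simp)).2

theorem finrank_span_pair_eq_two {a b : M} (h : LinearIndependent F ![a, b]) :
    Module.finrank F (Submodule.span F {a, b}) = 2 := by
  have := finrank_span_eq_card h
  rwa [Matrix.range_cons_cons_empty, Fintype.card_fin] at this

theorem mem_span_pair_of_finrank_eq_two (hM : Module.finrank F M = 2) {a b : M}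
    (h : LinearIndependent F ![a, b]) (c : M) : c ∈ Submodule.span F {a, b} := by
  have := Module.finite_of_finrank_pos (R := F) (M := M) (by omega)
  rw [Submodule.eq_top_of_finrank_eq ((finrank_span_pair_eq_two h).trans hM.symm)]
  exact Submodule.mem_top

theorem linearIndependent_pair_add_smul_add_smul {a b : M} (h : LinearIndependent F ![a, b])
    {s t : F} (hst : s ≠ t) : LinearIndependent F ![a + s • b, a + t • b] := by
  simpa using (LinearIndependent.pair_add_smul_add_smul_iff 1 s 1 t).2
    ⟨h, by simpa using hst.symm⟩

theorem linearIndependent_pair_add_smul_smul {a b : M} (h : LinearIndependent F ![a, b])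
    (s : F) {t : F} (ht : t ≠ 0) : LinearIndependent F ![a + s • b, t • b] := by
  simpa using (LinearIndependent.pair_add_smul_add_smul_iff 1 s 0 t).2 ⟨h, by simpa using ht⟩

theorem span_pair_eq_span_pair_of_mem {a b c d : M} (hc : c ∈ Submodule.span F {a, b})
    (hd : d ∈ Submodule.span F {a, b}) (hcd : LinearIndependent F ![c, d]) :
    Submodule.span F {c, d} = Submodule.span F {a, b} := by
  have := FiniteDimensional.span_of_finite F (Set.toFinite {a, b})
  refine Submodule.eq_of_le_of_finrank_eq (Submodule.span_le.2 (Set.pair_subset hc hd)) ?_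
  obtain ⟨s, t, rfl⟩ := Submodule.mem_span_pair.1 hc
  obtain ⟨s', t', rfl⟩ := Submodule.mem_span_pair.1 hd
  rw [finrank_span_pair_eq_two hcd, finrank_span_pair_eq_two
    ((LinearIndependent.pair_add_smul_add_smul_iff ..).1 hcd).1]

theorem inf_sup_inf_eq_of_finrank_le {A B W : Submodule F M} [FiniteDimensional F W]
    (hAB : Disjoint A B)
    (hW : Module.finrank F W ≤
      Module.finrank F (A ⊓ W : Submodule F M) + Module.finrank F (B ⊓ W : Submodule F M)) :
    A ⊓ W ⊔ B ⊓ W = W := by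
  have := Submodule.finiteDimensional_inf_right A W
  have := Submodule.finiteDimensional_inf_right B W
  refine Submodule.eq_of_le_of_finrank_le (sup_le inf_le_right inf_le_right) ?_
  have hdim := Submodule.finrank_sup_add_finrank_inf_eq (A ⊓ W) (B ⊓ W)
  rw [(hAB.mono inf_le_left inf_le_left).eq_bot, finrank_bot, add_zero] at hdim
  rwa [hdim]

open scoped Function in
theorem exists_mem_of_pairwise_disjoint [Finite F] {ι : Type*} {A : ι → Submodule F M}
    {W : Submodule F M} [FiniteDimensional F W] {k : ℕ} (hA : Pairwise (Disjoint on A))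
    (hAW : ∀ i, A i ≤ W) (hk : ∀ i, Module.finrank F (A i) = k)
    (hι : Nat.card ι = Nat.card F ^ k + 1) (hW : Module.finrank F W = 2 * k) {p : M}
    (hp : p ∈ W) : ∃ i, p ∈ A i := by
  have : Finite ι := Nat.finite_of_card_ne_zero (by omega)
  have := Fintype.ofFinite ι
  have : Finite W := Module.finite_of_finite F
  have hWfin : (W : Set M).Finite := Set.toFinite _
  have hAfin (i) : (A i \ {0} : Set M).Finite := (hWfin.subset (hAW i)).sdiff
  have hAcard (i) : (A i \ {0} : Set M).ncard = Nat.card F ^ k - 1 := by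
    have : FiniteDimensional F (A i) := Submodule.finiteDimensional_of_le (hAW i)
    rw [Set.ncard_sdiff_singleton_of_mem (A i).zero_mem, ← hk i,
      ← Module.natCard_eq_pow_finrank (K := F) (V := A i)]
    rfl
  have hWcard : (W \ {0} : Set M).ncard = (Nat.card F ^ k + 1) * (Nat.card F ^ k - 1) := by
    rw [Set.ncard_sdiff_singleton_of_mem W.zero_mem, ← Nat.sq_sub_sq, one_pow, ← pow_mul,
      mul_comm k, ← hW, ← Module.natCard_eq_pow_finrank (K := F) (V := W)]
    rfl
  have hdisj : Pairwise (Disjoint on fun i => (A i \ {0} : Set M)) := fun i j hij =>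
    Set.disjoint_left.2 fun x hxi hxj =>
      hxi.2 (Submodule.disjoint_def.1 (hA hij) x hxi.1 hxj.1)
  have hcover : ⋃ i, (A i \ {0} : Set M) = (W : Set M) \ {0} := by
    refine Set.eq_of_subset_of_ncard_le
      (Set.iUnion_subset fun i => Set.sdiff_subset_sdiff_left (hAW i)) ?_ hWfin.sdiff
    rw [Set.ncard_iUnion_of_finite hAfin hdisj, finsum_congr hAcard, hWcard, ← hι,
      finsum_eq_sum_of_fintype, Finset.sum_const, Finset.card_univ, smul_eq_mul,
      Nat.card_eq_fintype_card]
  obtain rfl | hp0 := eq_or_ne p 0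
  · have : Nonempty ι := (Nat.card_pos_iff.1 (by omega)).1
    exact ⟨Classical.arbitrary ι, zero_mem _⟩
  · obtain ⟨i, hi⟩ := Set.mem_iUnion.1 (hcover.ge ⟨hp, hp0⟩)
    exact ⟨i, hi.1⟩

theorem exists_submodule_coe_eq_of_lineMap_mem {c : F} (hc0 : c ≠ 0) (hc1 : c ≠ 1) {T : Set M}
    (h0 : 0 ∈ T) (hT : ∀ a ∈ T, ∀ b ∈ T, ∀ r : F, AffineMap.lineMap a b r ∈ T) :
    ∃ p : Submodule F M, (p : Set M) = T := by
  have hsmul (r : F) {a : M} (ha : a ∈ T) : r • a ∈ T := by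
    simpa [AffineMap.lineMap_apply] using hT 0 h0 a ha r
  refine ⟨{ carrier := T, zero_mem' := h0, smul_mem' := fun r a ha => hsmul r ha, add_mem' := ?_ },
    rfl⟩
  intro a b ha hb
  have hab := hT _ (hsmul (1 - c)⁻¹ ha) _ (hsmul c⁻¹ hb) c
  rwa [AffineMap.lineMap_apply_module, smul_smul, smul_smul,
    mul_inv_cancel₀ (sub_ne_zero.2 hc1.symm), mul_inv_cancel₀ hc0, one_smul, one_smul] at hab

end LinearAlgebra

section Hua

variable {K : Type*} [Field K]

theorem sub_inv_inv_add_inv_sub {a c : K} (ha : a ≠ 0) (hc : c ≠ 0) (hca : c - a ≠ 0) :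
    a - (a⁻¹ + (c - a)⁻¹)⁻¹ = a ^ 2 * c⁻¹ := by
  have : c - a + a ≠ 0 := by simpa using hc
  have : a⁻¹ + (c - a)⁻¹ = c * (a * (c - a))⁻¹ := by field_simp; ring
  rw [this, mul_inv, inv_inv]
  field_simp
  ring

/-- Closure of an additive subgroup of a field under harmonic sums `(x⁻¹ + y⁻¹)⁻¹`, the hypothesis
of Hua's argument. Since `0⁻¹ = 0`, nothing is imposed on pairs with `x = 0`, `y = 0` or
`x + y = 0`. -/
def IsHarmonic (T : AddSubgroup K) : Prop :=
  ∀ x ∈ T, ∀ y ∈ T, (x⁻¹ + y⁻¹)⁻¹ ∈ T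

namespace IsHarmonic

variable {T : AddSubgroup K}

theorem sq_mul_inv_mem (hT : IsHarmonic T) {a c : K} (ha : a ∈ T) (hc : c ∈ T) :
    a ^ 2 * c⁻¹ ∈ T := by
  obtain rfl | ha0 := eq_or_ne a 0
  · simp
  obtain rfl | hc0 := eq_or_ne c 0
  · simp
  obtain rfl | hac := eq_or_ne c a
  · rwa [sq, mul_inv_cancel_right₀ hc0]
  rw [← sub_inv_inv_add_inv_sub ha0 hc0 (sub_ne_zero.2 hac)]
  exact T.sub_mem ha (hT a ha _ (T.sub_mem hc ha))

theorem inv_mem (hT : IsHarmonic T) (h1 : 1 ∈ T) {a : K} (ha : a ∈ T) : a⁻¹ ∈ T := by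
  simpa using hT.sq_mul_inv_mem h1 ha

theorem sq_mul_mem (hT : IsHarmonic T) (h1 : 1 ∈ T) {a c : K} (ha : a ∈ T) (hc : c ∈ T) :
    a ^ 2 * c ∈ T := by
  simpa using hT.sq_mul_inv_mem ha (hT.inv_mem h1 hc)

theorem exists_sq_eq [Finite K] (hT : IsHarmonic T) (h1 : 1 ∈ T) (h2 : (2 : K) = 0) {a : K}
    (ha : a ∈ T) : ∃ b ∈ T, b ^ 2 = a := by
  let sq : T → T := fun b => ⟨b ^ 2, by simpa using hT.sq_mul_mem h1 b.2 h1⟩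
  have hsq : Function.Injective sq := fun b c hbc => by
    have hbc : (b : K) ^ 2 = c ^ 2 := congrArg Subtype.val hbc
    have : ((b : K) - c) ^ 2 = 0 := by linear_combination hbc + ((c : K) ^ 2 - b * c) * h2
    exact Subtype.ext (sub_eq_zero.1 (pow_eq_zero_iff two_ne_zero |>.1 this))
  obtain ⟨b, hb⟩ := Finite.surjective_of_injective hsq ⟨a, ha⟩
  exact ⟨b, b.2, congrArg Subtype.val hb⟩

theorem mul_mem [Finite K] (hT : IsHarmonic T) (h1 : 1 ∈ T) {a c : K} (ha : a ∈ T) (hc : c ∈ T) :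
    a * c ∈ T := by
  obtain h2 | h2 := eq_or_ne (2 : K) 0
  · obtain ⟨b, hb, rfl⟩ := hT.exists_sq_eq h1 h2 ha
    exact hT.sq_mul_mem h1 hb hc
  · have hhalf {x : K} (hx : x ∈ T) : x / 2 ∈ T := by
      have := hT x hx x hx
      rwa [← two_mul, mul_inv, inv_inv, mul_comm, ← div_eq_mul_inv] at this
    have h2ac := T.sub_mem (T.sub_mem (hT.sq_mul_mem h1 (T.add_mem ha h1) hc)
      (hT.sq_mul_mem h1 ha hc)) hc
    convert hhalf h2ac using 1
    field_simp
    ring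

theorem exists_subfield_coe_eq [Finite K] (hT : IsHarmonic T) (h1 : 1 ∈ T) :
    ∃ E : Subfield K, (E : Set K) = T :=
  ⟨{ T with
      one_mem' := h1
      mul_mem' := hT.mul_mem h1
      inv_mem' := fun _ => hT.inv_mem h1 }, rfl⟩

end IsHarmonic

theorem mem_subfield_iff_pow_natCard_eq_self (E : Subfield K) [Finite E] {x : K} :
    x ∈ E ↔ x ^ Nat.card E = x := by
  have := Fintype.ofFinite E
  have hsplits := Polynomial.splits_X_pow_nat_card_sub_X (K := E)
  have hne := FiniteField.X_pow_card_sub_X_ne_zero K (Finite.one_lt_card (α := E))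
  rw [Nat.card_eq_fintype_card] at hsplits hne ⊢
  have hroots : (Polynomial.X ^ Fintype.card E - Polynomial.X : Polynomial K).roots =
      Finset.univ.val.map E.subtype := by
    rw [← FiniteField.roots_X_pow_card_sub_X, ← hsplits.roots_map E.subtype, Polynomial.map_sub,
      Polynomial.map_pow, Polynomial.map_X]
  have hmem : x ∈ Finset.univ.val.map E.subtype ↔ x ∈ E := by simp
  rw [← hmem, ← hroots, Polynomial.mem_roots hne]
  simp [sub_eq_zero]

theorem subfield_eq_of_natCard_eq [Finite K] {E E' : Subfield K} (h : Nat.card E = Nat.card E') :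
    E = E' :=
  SetLike.ext fun x => by
    rw [mem_subfield_iff_pow_natCard_eq_self, mem_subfield_iff_pow_natCard_eq_self, h]

end Hua

section Pencil

variable {F L V : Type*} [Field F] [AddCommGroup L] [Module F L] [AddCommGroup V] [Module F V]
  {α β f g : L →ₗ[F] V} {A B C M : Submodule F V}

/-- The one-parameter family of ranges of the nonzero combinations of two linear maps. When the
ranges of `α` and `β` are complementary this is the regulus through the ranges of `α`, `β` and
`α + β`. -/
def pencil (α β : L →ₗ[F] V) : Set (Submodule F V) :=
  LinearMap.range '' {f | f ∈ Submodule.span F {α, β} ∧ f ≠ 0}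

theorem range_mem_pencil (hf : f ∈ Submodule.span F {α, β}) (hf0 : f ≠ 0) :
    LinearMap.range f ∈ pencil α β :=
  Set.mem_image_of_mem _ ⟨hf, hf0⟩

theorem mem_pencil_iff (h : LinearIndependent F ![α, β]) :
    A ∈ pencil α β ↔ A = LinearMap.range β ∨ ∃ t : F, A = LinearMap.range (α + t • β) := by
  constructor
  · rintro ⟨f, ⟨hf, hf0⟩, rfl⟩
    obtain ⟨s, t, rfl⟩ := Submodule.mem_span_pair.1 hf
    obtain rfl | hs := eq_or_ne s 0
    · have ht : t ≠ 0 := by rintro rfl; simp at hf0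
      left
      rw [zero_smul, zero_add, LinearMap.range_smul _ _ ht]
    · right
      refine ⟨s⁻¹ * t, ?_⟩
      rw [← LinearMap.range_smul (α + _) s hs, smul_add, smul_smul, mul_inv_cancel_left₀ hs]
  · rintro (rfl | ⟨t, rfl⟩)
    · exact range_mem_pencil (Submodule.subset_span (by simp)) (h.ne_zero 1)
    · refine range_mem_pencil (Submodule.mem_span_pair.2 ⟨1, t, by rw [one_smul]⟩) fun h0 => ?_
      simpa using (LinearIndependent.pair_iff.1 h 1 t (by rwa [one_smul])).1

theorem linearIndependent_of_range_ne (hf : f ≠ 0) (hg : g ≠ 0)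
    (hfg : LinearMap.range f ≠ LinearMap.range g) : LinearIndependent F ![f, g] := by
  rw [LinearIndependent.pair_iff' hf]
  rintro c rfl
  exact hfg (LinearMap.range_smul f c (left_ne_zero_of_smul hg)).symm

theorem linearIndependent_apply_of_injective_coprod (h : Function.Injective (α.coprod β)) {x : L}
    (hx : x ≠ 0) : LinearIndependent F ![α x, β x] := by
  refine LinearIndependent.pair_iff.2 fun s t hst => ?_
  have : α.coprod β (s • x, t • x) = 0 := by simpa using hst
  simpa [hx] using (map_eq_zero_iff _ h).1 this

theorem linearIndependent_of_injective_coprod [Nontrivial L]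
    (h : Function.Injective (α.coprod β)) : LinearIndependent F ![α, β] := by
  obtain ⟨x, hx⟩ := exists_ne (0 : L)
  refine LinearIndependent.pair_iff.2 fun s t hst => ?_
  exact LinearIndependent.pair_iff.1 (linearIndependent_apply_of_injective_coprod h hx) s t
    (LinearMap.congr_fun hst x)

theorem disjoint_range_of_injective_coprod (h : Function.Injective (α.coprod β)) :
    Disjoint (LinearMap.range α) (LinearMap.range β) := by
  refine Submodule.disjoint_def.2 ?_
  rintro _ ⟨x, rfl⟩ ⟨y, hxy⟩
  have : α.coprod β (x, -y) = 0 := by simp [hxy]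
  have : x = 0 := congrArg Prod.fst ((map_eq_zero_iff _ h).1 this)
  rw [this, map_zero]

theorem injective_of_mem_span_pair (h : Function.Injective (α.coprod β))
    (hf : f ∈ Submodule.span F {α, β}) (hf0 : f ≠ 0) : Function.Injective f := by
  obtain ⟨s, t, rfl⟩ := Submodule.mem_span_pair.1 hf
  refine (injective_iff_map_eq_zero _).2 fun x hx => ?_
  have : α.coprod β (s • x, t • x) = 0 := by simpa using hx
  by_contra hx0
  obtain ⟨rfl, rfl⟩ : s = 0 ∧ t = 0 := by simpa [hx0] using (map_eq_zero_iff _ h).1 this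
  simp at hf0

theorem injective_coprod_of_mem_span_pair (h : Function.Injective (α.coprod β))
    (hf : f ∈ Submodule.span F {α, β}) (hg : g ∈ Submodule.span F {α, β})
    (hfg : LinearIndependent F ![f, g]) : Function.Injective (f.coprod g) := by
  obtain ⟨a, b, rfl⟩ := Submodule.mem_span_pair.1 hf
  obtain ⟨c, d, rfl⟩ := Submodule.mem_span_pair.1 hg
  have hdet := sub_ne_zero.2 ((LinearIndependent.pair_add_smul_add_smul_iff ..).1 hfg).2
  refine (injective_iff_map_eq_zero _).2 fun ⟨x, y⟩ hxy => ?_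
  have : α.coprod β (a • x + c • y, b • x + d • y) = 0 := by
    rw [← hxy]
    simp only [LinearMap.coprod_apply, LinearMap.add_apply, LinearMap.smul_apply, map_add, map_smul]
    abel
  obtain ⟨h₁, h₂⟩ := Prod.mk_eq_zero.1 ((map_eq_zero_iff _ h).1 this)
  have hx : (a * d - b * c) • x = 0 := by
    linear_combination (norm := module) d • h₁ - c • h₂
  have hy : (a * d - b * c) • y = 0 := by
    linear_combination (norm := module) a • h₂ - b • h₁
  rw [(smul_eq_zero_iff_right hdet).1 hx, (smul_eq_zero_iff_right hdet).1 hy, Prod.mk_zero_zero]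

theorem exists_frame_of_mem_pencil (h : Function.Injective (α.coprod β))
    (hA : A ∈ pencil α β) (hB : B ∈ pencil α β) (hC : C ∈ pencil α β)
    (hAB : A ≠ B) (hAC : A ≠ C) (hBC : B ≠ C) :
    ∃ f g : L →ₗ[F] V, Function.Injective (f.coprod g) ∧ pencil f g = pencil α β ∧
      LinearMap.range f = A ∧ LinearMap.range g = B ∧ LinearMap.range (f + g) = C := by
  obtain ⟨f, ⟨hf, hf0⟩, rfl⟩ := hA
  obtain ⟨g, ⟨hg, hg0⟩, rfl⟩ := hB
  obtain ⟨e, ⟨he, he0⟩, rfl⟩ := hC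
  have hfg := linearIndependent_of_range_ne hf0 hg0 hAB
  obtain ⟨s, t, hs, ht, rfl⟩ := exists_smul_add_smul_eq_of_mem_span_pair
    ((span_pair_eq_span_pair_of_mem hf hg hfg).symm ▸ he)
    (linearIndependent_of_range_ne hf0 he0 hAC) (linearIndependent_of_range_ne hg0 he0 hBC)
  have hsf := Submodule.smul_mem _ s hf
  have htg := Submodule.smul_mem _ t hg
  have hst : LinearIndependent F ![s • f, t • g] := by
    simpa using (LinearIndependent.pair_add_smul_add_smul_iff s 0 0 t).2 ⟨hfg, by simp [hs, ht]⟩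
  exact ⟨s • f, t • g, injective_coprod_of_mem_span_pair h hsf htg hst,
    by rw [pencil, pencil, span_pair_eq_span_pair_of_mem hsf htg hst],
    LinearMap.range_smul f s hs, LinearMap.range_smul g t ht, rfl⟩

theorem inf_ne_bot_of_mem_pencil (h : Function.Injective (α.coprod β))
    (hM : M ≤ LinearMap.range α ⊓ M ⊔ LinearMap.range β ⊓ M)
    (hαβ : LinearMap.range (α + β) ⊓ M ≠ ⊥) (hA : A ∈ pencil α β) : A ⊓ M ≠ ⊥ := by
  obtain ⟨_, ⟨⟨z, rfl⟩, hzM⟩, hz⟩ := Submodule.exists_mem_ne_zero_of_ne_bot hαβ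
  have hz0 : z ≠ 0 := by rintro rfl; simp at hz
  obtain ⟨hαz, hβz⟩ : α z ∈ M ∧ β z ∈ M := by
    obtain ⟨_, ⟨⟨x, rfl⟩, hx⟩, _, ⟨⟨y, rfl⟩, hy⟩, hxy⟩ := Submodule.mem_sup.1 (hM hzM)
    obtain ⟨rfl, rfl⟩ := Prod.mk.inj (h (show α.coprod β (x, y) = α.coprod β (z, z) by simpa))
    exact ⟨hx, hy⟩
  obtain ⟨f, ⟨hf, hf0⟩, rfl⟩ := hA
  refine Submodule.ne_bot_iff _ |>.2 ⟨f z, ⟨⟨z, rfl⟩, ?_⟩,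
    (map_ne_zero_iff f (injective_of_mem_span_pair h hf hf0)).2 hz0⟩
  obtain ⟨s, t, rfl⟩ := Submodule.mem_span_pair.1 hf
  exact M.add_mem (M.smul_mem s hαz) (M.smul_mem t hβz)

theorem range_le_range_coprod_of_mem_span_pair (hf : f ∈ Submodule.span F {α, β}) :
    LinearMap.range f ≤ LinearMap.range (α.coprod β) := by
  obtain ⟨s, t, rfl⟩ := Submodule.mem_span_pair.1 hf
  rintro _ ⟨x, rfl⟩
  exact ⟨(s • x, t • x), by simp⟩

theorem finrank_range_coprod [FiniteDimensional F L] (h : Function.Injective (α.coprod β)) :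
    Module.finrank F (LinearMap.range (α.coprod β)) = 2 * Module.finrank F L := by
  rw [LinearMap.finrank_range_of_inj h, Module.finrank_prod, two_mul]

theorem range_ne_of_mem_span_pair (h : Function.Injective (α.coprod β))
    (hf : f ∈ Submodule.span F {α, β}) (hg : g ∈ Submodule.span F {α, β})
    (hfg : LinearIndependent F ![f, g]) : LinearMap.range f ≠ LinearMap.range g := by
  have hdisj := disjoint_range_of_injective_coprod (injective_coprod_of_mem_span_pair h hf hg hfg)
  exact fun hrange => hfg.ne_zero 0
    (LinearMap.range_eq_bot.1 (disjoint_self.1 (hrange.symm ▸ hdisj)))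

theorem ncard_pencil [Finite F] [Nontrivial L] (h : Function.Injective (α.coprod β)) :
    (pencil α β).ncard = Nat.card F + 1 := by
  have hαβ := linearIndependent_of_injective_coprod h
  have hmem (t : F) : α + t • β ∈ Submodule.span F {α, β} :=
    Submodule.mem_span_pair.2 ⟨1, t, by rw [one_smul]⟩
  have hpencil : pencil α β =
      insert (LinearMap.range β) (Set.range fun t : F => LinearMap.range (α + t • β)) :=
    Set.ext fun A => by simp only [mem_pencil_iff hαβ, Set.mem_insert_iff, Set.mem_range, eq_comm]
  rw [hpencil, Set.ncard_insert_of_notMem, Set.ncard_range_of_injective]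
  · intro s t hst
    by_contra hne
    exact range_ne_of_mem_span_pair h (hmem s) (hmem t)
      (linearIndependent_pair_add_smul_add_smul hαβ hne) hst
  · rintro ⟨t, ht⟩
    exact range_ne_of_mem_span_pair h (hmem t) (Submodule.subset_span (by simp))
      (by simpa using hαβ) ht

theorem isRegulus_pencil [Finite F] [FiniteDimensional F L] [Nontrivial L]
    (h : Function.Injective (α.coprod β)) :
    IsRegulus F (Module.finrank F L) (pencil α β) where
  ncard_eq := ncard_pencil h
  finrank_eq := by
    rintro _ ⟨f, ⟨hf, hf0⟩, rfl⟩
    exact LinearMap.finrank_range_of_inj (injective_of_mem_span_pair h hf hf0)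
  pairwise_disjoint := by
    rintro _ ⟨f, ⟨hf, hf0⟩, rfl⟩ _ ⟨g, ⟨hg, hg0⟩, rfl⟩ hfg
    exact (disjoint_range_of_injective_coprod (injective_coprod_of_mem_span_pair h hf hg
      (linearIndependent_of_range_ne hf0 hg0 hfg))).eq_bot
  ambient := by
    refine ⟨LinearMap.range (α.coprod β), finrank_range_coprod h, ?_⟩
    rintro _ ⟨f, ⟨hf, -⟩, rfl⟩
    exact range_le_range_coprod_of_mem_span_pair hf
  transversal := by
    rintro l hl ⟨A, hA, B, hB, C, hC, hAB, hAC, hBC, hAl, hBl, hCl⟩ D hD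
    have : FiniteDimensional F l := .of_finrank_pos (by omega)
    obtain ⟨f, g, hfg, hpencil, rfl, rfl, rfl⟩ := exists_frame_of_mem_pencil h hA hB hC hAB hAC hBC
    refine inf_ne_bot_of_mem_pencil hfg (inf_sup_inf_eq_of_finrank_le
      (disjoint_range_of_injective_coprod hfg) ?_).ge hCl (hpencil ▸ hD)
    have := Submodule.finiteDimensional_inf_right (LinearMap.range f) l
    have := Submodule.finiteDimensional_inf_right (LinearMap.range g) l
    have := Submodule.one_le_finrank_iff.2 hAl
    have := Submodule.one_le_finrank_iff.2 hBl
    omega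

theorem exists_eq_range_add_comp [FiniteDimensional F L] (h : Function.Injective (α.coprod β))
    {D : Submodule F V} (hD : D ≤ LinearMap.range (α.coprod β))
    (hDβ : Disjoint D (LinearMap.range β)) (hrank : Module.finrank F D = Module.finrank F L) :
    ∃ g : L →ₗ[F] L, D = LinearMap.range (α + β ∘ₗ g) := by
  set G := D.comap (α.coprod β)
  have hGD : G.map (α.coprod β) = D := Submodule.map_comap_eq_of_le hD
  have hG : Module.finrank F G = Module.finrank F L := by
    rw [← hrank, ← hGD, (Submodule.equivMapOfInjective _ h G).finrank_eq]
  have hinj : Function.Injective (LinearMap.fst F L L ∘ₗ G.subtype) := by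
    refine (injective_iff_map_eq_zero _).2 ?_
    rintro ⟨⟨x, y⟩, hxy⟩ (rfl : x = 0)
    have hβy : β y = 0 := Submodule.disjoint_def.1 hDβ _ (by simpa [G] using hxy) ⟨y, rfl⟩
    have := (map_eq_zero_iff _ h).1 (show α.coprod β (0, y) = 0 by simpa)
    exact Subtype.ext this
  obtain ⟨g, hg⟩ := Submodule.exists_eq_graph
    ⟨hinj, (LinearMap.injective_iff_surjective_of_finrank_eq_finrank hG).1 hinj⟩
  refine ⟨g, ?_⟩
  rw [← hGD, hg, LinearMap.graph_eq_range_prod, ← LinearMap.range_comp, LinearMap.coprod_comp_prod,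
    LinearMap.comp_id]

theorem not_linearIndependent_of_transversal (h : Function.Injective (α.coprod β))
    (g : L →ₗ[F] L) {x : L} (hx : LinearMap.range (α + β ∘ₗ g) ⊓ Submodule.span F {α x, β x} ≠ ⊥) :
    ¬LinearIndependent F ![x, g x] := by
  obtain ⟨_, ⟨⟨y, rfl⟩, hy⟩, hy0⟩ := Submodule.exists_mem_ne_zero_of_ne_bot hx
  obtain ⟨s, t, hst⟩ := Submodule.mem_span_pair.1 hy
  obtain ⟨rfl, hty⟩ := Prod.mk.inj
    (h (show α.coprod β (s • x, t • x) = α.coprod β (y, g y) by simpa))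
  rw [map_smul] at hty
  intro hli
  have := LinearIndependent.pair_iff.1 hli t (-s) (by rw [hty]; module)
  simp [neg_eq_zero.1 this.2] at hy0

variable {R : Set (Submodule F V)}

theorem IsRegulus.le_range_coprod [FiniteDimensional F L] [Nontrivial L]
    (hR : IsRegulus F (Module.finrank F L) R) (h : Function.Injective (α.coprod β))
    (hα : LinearMap.range α ∈ R) (hβ : LinearMap.range β ∈ R) {D : Submodule F V} (hD : D ∈ R) :
    D ≤ LinearMap.range (α.coprod β) := by
  obtain ⟨W, hW, hRW⟩ := hR.ambient
  have hL : 0 < Module.finrank F L := Module.finrank_pos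
  have : FiniteDimensional F W := .of_finrank_pos (by omega)
  rw [Submodule.eq_of_le_of_finrank_eq ?_ ((finrank_range_coprod h).trans hW.symm)]
  · exact hRW D hD
  · rw [LinearMap.range_coprod]
    exact sup_le (hRW _ hα) (hRW _ hβ)

theorem IsRegulus.inf_span_pair_ne_bot {n : ℕ} (hR : IsRegulus F n R)
    (h : Function.Injective (α.coprod β)) (hα : LinearMap.range α ∈ R)
    (hβ : LinearMap.range β ∈ R) (hαβ : LinearMap.range (α + β) ∈ R) {D : Submodule F V}
    (hD : D ∈ R) {x : L} (hx : x ≠ 0) : D ⊓ Submodule.span F {α x, β x} ≠ ⊥ := by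
  have := nontrivial_of_ne x 0 hx
  have hli := linearIndependent_of_injective_coprod h
  have hα' : α ∈ Submodule.span F {α, β} := Submodule.subset_span (by simp)
  have hβ' : β ∈ Submodule.span F {α, β} := Submodule.subset_span (by simp)
  have hα_add : LinearIndependent F ![α, α + β] := by simpa using hli
  have hβ_add : LinearIndependent F ![β, α + β] := by
    rw [add_comm]
    simpa using LinearIndependent.pair_symm_iff.1 hli
  have hmeet {f : L →ₗ[F] V} (hf : f ∈ Submodule.span F {α, β}) (hf0 : f ≠ 0) :
      LinearMap.range f ⊓ Submodule.span F {α x, β x} ≠ ⊥ := by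
    refine (Submodule.ne_bot_iff _).2 ⟨f x, ⟨⟨x, rfl⟩, ?_⟩,
      (map_ne_zero_iff f (injective_of_mem_span_pair h hf hf0)).2 hx⟩
    obtain ⟨s, t, rfl⟩ := Submodule.mem_span_pair.1 hf
    exact Submodule.mem_span_pair.2 ⟨s, t, rfl⟩
  exact hR.transversal _
    (finrank_span_pair_eq_two (linearIndependent_apply_of_injective_coprod h hx))
    ⟨_, hα, _, hβ, _, hαβ, range_ne_of_mem_span_pair h hα' hβ' hli,
      range_ne_of_mem_span_pair h hα' (add_mem hα' hβ') hα_add,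
      range_ne_of_mem_span_pair h hβ' (add_mem hα' hβ') hβ_add,
      hmeet hα' (hli.ne_zero 0), hmeet hβ' (hli.ne_zero 1),
      hmeet (add_mem hα' hβ') (hα_add.ne_zero 1)⟩ D hD

theorem IsRegulus.subset_pencil [FiniteDimensional F L] [Nontrivial L]
    (hR : IsRegulus F (Module.finrank F L) R) (h : Function.Injective (α.coprod β))
    (hα : LinearMap.range α ∈ R) (hβ : LinearMap.range β ∈ R)
    (hαβ : LinearMap.range (α + β) ∈ R) : R ⊆ pencil α β := by
  have hli := linearIndependent_of_injective_coprod h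
  intro D hD
  rw [mem_pencil_iff hli, or_iff_not_imp_left]
  intro hDβ
  obtain ⟨g, rfl⟩ := exists_eq_range_add_comp h (hR.le_range_coprod h hα hβ hD)
    (disjoint_iff.2 (hR.pairwise_disjoint _ hD _ hβ hDβ)) (hR.finrank_eq _ hD)
  obtain ⟨c, rfl⟩ := g.exists_eq_smul_id_of_forall_notLinearIndependent fun x hxg => by
    exact not_linearIndependent_of_transversal h g
      (hR.inf_span_pair_ne_bot h hα hβ hαβ hD (hxg.ne_zero 0)) hxg
  exact ⟨c, by rw [LinearMap.comp_smul, Module.End.one_eq_id, LinearMap.comp_id]⟩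

theorem isRegulusThrough_iff [Finite F] [FiniteDimensional F L] [Nontrivial L]
    (h : Function.Injective (α.coprod β)) :
    IsRegulusThrough F (Module.finrank F L) (LinearMap.range α) (LinearMap.range β)
      (LinearMap.range (α + β)) R ↔ R = pencil α β := by
  have hpencil := isRegulus_pencil h
  have hli := linearIndependent_of_injective_coprod h
  constructor
  · rintro ⟨hR, hα, hβ, hαβ⟩
    refine Set.eq_of_subset_of_ncard_le (hR.subset_pencil h hα hβ hαβ) ?_
      (Set.finite_of_ncard_ne_zero (by rw [hpencil.ncard_eq]; omega))
    rw [hR.ncard_eq, hpencil.ncard_eq]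
  · rintro rfl
    refine ⟨hpencil, ?_, ?_, ?_⟩
    · exact (mem_pencil_iff hli).2 (.inr ⟨0, by rw [zero_smul, add_zero]⟩)
    · exact (mem_pencil_iff hli).2 (.inl rfl)
    · exact (mem_pencil_iff hli).2 (.inr ⟨1, by rw [one_smul]⟩)

end Pencil

section Spread

variable (F K : Type*) [Field F] [Field K] [Algebra F K]

/-- The identification of `K × K` with the hyperplane at infinity `c = 0`. -/
def inclInfinity : K × K →ₗ[F] K × K × F :=
  LinearMap.prodMap LinearMap.id (LinearMap.inl F K F)

variable {K}

/-- The parametrization `x ↦ x • w` of the element of the Desarguesian spread through `w`. It is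
bundled as a linear function of `w`, so that elements of an `F`-span in `K × K` yield a pencil. -/
def spreadMap : K × K →ₗ[F] K →ₗ[F] K × K × F :=
  LinearMap.mk₂ F (fun w x => inclInfinity F K (x • w))
    (fun w w' x => by rw [smul_add, map_add]) (fun c w x => by rw [smul_comm, map_smul])
    (fun w x y => by rw [add_smul, map_add]) (fun c w x => by rw [smul_assoc, map_smul])

/-- The element of the Desarguesian spread through the point with coordinate vector `w`. -/
def spreadThrough (w : K × K) : Submodule F (K × K × F) :=
  LinearMap.range (spreadMap F w)

variable {F} {E : IntermediateField F K} {u v w : K × K} {A B C : Submodule F (K × K × F)}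

theorem inclInfinity_injective : Function.Injective (inclInfinity F K) :=
  Function.injective_id.prodMap (LinearMap.inl_injective)

theorem spreadMap_apply (w : K × K) (x : K) : spreadMap F w x = inclInfinity F K (x • w) := rfl

theorem spreadMap_injective (hw : w ≠ 0) : Function.Injective (spreadMap F w) :=
  inclInfinity_injective.comp (smul_left_injective K hw)

theorem injective_coprod_spreadMap (h : LinearIndependent K ![u, v]) :
    Function.Injective ((spreadMap F u).coprod (spreadMap F v)) := by
  refine (injective_iff_map_eq_zero _).2 fun ⟨x, y⟩ hxy => ?_
  rw [LinearMap.coprod_apply, spreadMap_apply, spreadMap_apply, ← map_add,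
    map_eq_zero_iff _ inclInfinity_injective] at hxy
  exact Prod.ext_iff.2 (LinearIndependent.pair_iff.1 h x y hxy)

theorem spreadElement_eq_map (E : IntermediateField F K) (w : K × K) :
    spreadElement E w.1 w.2 = (Subalgebra.toSubmodule E.toSubalgebra).map (spreadMap F w) := by
  ext p
  change (∃ x ∈ E, p = (w.1 * x, w.2 * x, 0)) ↔ ∃ x ∈ E, (x * w.1, x * w.2, (0 : F)) = p
  simp only [mul_comm, eq_comm]

theorem spreadElement_top (w : K × K) : spreadElement ⊤ w.1 w.2 = spreadThrough F w := by
  rw [spreadElement_eq_map, IntermediateField.top_toSubalgebra, Algebra.top_toSubmodule,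
    Submodule.map_top, spreadThrough]

theorem spreadElement_le_spreadThrough (E : IntermediateField F K) (w : K × K) :
    spreadElement E w.1 w.2 ≤ spreadThrough F w := by
  rw [spreadElement_eq_map]
  exact LinearMap.map_le_range

theorem finrank_spreadElement (E : IntermediateField F K) (hw : w ≠ 0) :
    Module.finrank F (spreadElement E w.1 w.2) = Module.finrank F E := by
  rw [spreadElement_eq_map]
  exact (Submodule.equivMapOfInjective _ (spreadMap_injective hw) _).finrank_eq.symm

theorem finrank_of_mem_subspread (hA : A ∈ subspread E) :
    Module.finrank F A = Module.finrank F E := by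
  obtain ⟨a, b, hab, rfl⟩ := hA
  exact finrank_spreadElement E (w := (a, b)) hab

theorem mem_desarguesianSpread :
    A ∈ desarguesianSpread F K ↔ ∃ w : K × K, w ≠ 0 ∧ A = spreadThrough F w := by
  simp only [← spreadElement_top]
  exact Prod.exists'.symm

theorem mem_spreadThrough {p : K × K × F} :
    p ∈ spreadThrough F w ↔ ∃ x : K, inclInfinity F K (x • w) = p :=
  LinearMap.mem_range

theorem spreadThrough_smul {c : K} (hc : c ≠ 0) (w : K × K) :
    spreadThrough F (c • w) = spreadThrough F w := by
  ext p
  simp only [mem_spreadThrough, smul_smul]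
  exact ((Equiv.mulRight₀ c hc).surjective.exists
    (p := fun y => inclInfinity F K (y • w) = p)).symm

theorem spreadThrough_ne_iff (hu : u ≠ 0) (hv : v ≠ 0) :
    spreadThrough F u ≠ spreadThrough F v ↔ LinearIndependent K ![u, v] := by
  rw [LinearIndependent.pair_iff' hu, ← not_exists, not_iff_not]
  constructor
  · intro h
    obtain ⟨x, hx⟩ := mem_spreadThrough.1 (h ▸ mem_spreadThrough.2 ⟨1, rfl⟩ :
      inclInfinity F K ((1 : K) • v) ∈ spreadThrough F u)
    exact ⟨x, by simpa using inclInfinity_injective hx⟩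
  · rintro ⟨c, rfl⟩
    exact (spreadThrough_smul (left_ne_zero_of_smul hv) u).symm

theorem spreadThrough_ne (h : LinearIndependent K ![u, v]) :
    spreadThrough F u ≠ spreadThrough F v :=
  (spreadThrough_ne_iff (h.ne_zero 0) (h.ne_zero 1)).2 h

theorem disjoint_spreadThrough (h : LinearIndependent K ![u, v]) :
    Disjoint (spreadThrough F u) (spreadThrough F v) :=
  disjoint_range_of_injective_coprod (injective_coprod_spreadMap h)

theorem disjoint_of_mem_desarguesianSpread (hA : A ∈ desarguesianSpread F K)
    (hB : B ∈ desarguesianSpread F K) (hAB : A ≠ B) : Disjoint A B := by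
  obtain ⟨u, hu, rfl⟩ := mem_desarguesianSpread.1 hA
  obtain ⟨v, hv, rfl⟩ := mem_desarguesianSpread.1 hB
  exact disjoint_spreadThrough ((spreadThrough_ne_iff hu hv).1 hAB)

theorem exists_frame_of_mem_desarguesianSpread (hA : A ∈ desarguesianSpread F K)
    (hB : B ∈ desarguesianSpread F K) (hC : C ∈ desarguesianSpread F K)
    (hAB : A ≠ B) (hAC : A ≠ C) (hBC : B ≠ C) :
    ∃ u v : K × K, LinearIndependent K ![u, v] ∧
      spreadThrough F u = A ∧ spreadThrough F v = B ∧ spreadThrough F (u + v) = C := by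
  obtain ⟨u, hu, rfl⟩ := mem_desarguesianSpread.1 hA
  obtain ⟨v, hv, rfl⟩ := mem_desarguesianSpread.1 hB
  obtain ⟨w, hw, rfl⟩ := mem_desarguesianSpread.1 hC
  have huv := (spreadThrough_ne_iff hu hv).1 hAB
  obtain ⟨s, t, hs, ht, rfl⟩ := exists_smul_add_smul_eq_of_mem_span_pair
    (mem_span_pair_of_finrank_eq_two (by simp) huv w) ((spreadThrough_ne_iff hu hw).1 hAC)
    ((spreadThrough_ne_iff hv hw).1 hBC)
  refine ⟨s • u, t • v, ?_, spreadThrough_smul hs u, spreadThrough_smul ht v, rfl⟩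
  refine (spreadThrough_ne_iff (F := F) (smul_ne_zero hs hu) (smul_ne_zero ht hv)).1 ?_
  rwa [spreadThrough_smul hs, spreadThrough_smul ht]

theorem pencil_spreadMap_subset (u v : K × K) :
    pencil (spreadMap F u) (spreadMap F v) ⊆ desarguesianSpread F K := by
  rintro _ ⟨f, ⟨hf, hf0⟩, rfl⟩
  obtain ⟨s, t, rfl⟩ := Submodule.mem_span_pair.1 hf
  rw [← map_smul, ← map_smul, ← map_add] at hf0 ⊢
  exact mem_desarguesianSpread.2 ⟨_, by rintro h0; simp [h0] at hf0, rfl⟩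

theorem isRegulusThrough_spreadThrough_iff [Finite F] [FiniteDimensional F K]
    (h : LinearIndependent K ![u, v]) {R : Set (Submodule F (K × K × F))} :
    IsRegulusThrough F (Module.finrank F K) (spreadThrough F u) (spreadThrough F v)
      (spreadThrough F (u + v)) R ↔ R = pencil (spreadMap F u) (spreadMap F v) := by
  rw [spreadThrough, spreadThrough, spreadThrough, map_add]
  exact isRegulusThrough_iff (injective_coprod_spreadMap h)

theorem existsUnique_isRegulusThrough [Finite F] [FiniteDimensional F K]
    (hA : A ∈ desarguesianSpread F K) (hB : B ∈ desarguesianSpread F K)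
    (hC : C ∈ desarguesianSpread F K) (hAB : A ≠ B) (hAC : A ≠ C) (hBC : B ≠ C) :
    ∃! R : Set (Submodule F (K × K × F)), IsRegulusThrough F (Module.finrank F K) A B C R := by
  obtain ⟨u, v, h, rfl, rfl, rfl⟩ := exists_frame_of_mem_desarguesianSpread hA hB hC hAB hAC hBC
  simp only [isRegulusThrough_spreadThrough_iff h, existsUnique_eq]

end Spread

/-- The closure condition on `S` in (2): every regulus of `(n - 1)`-spaces through three elements
of `S` is contained in `S`. -/
def IsRegulusClosed (F : Type*) {V : Type*} [Field F] [AddCommGroup V] [Module F V] (n : ℕ)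
    (S : Set (Submodule F V)) : Prop :=
  ∀ A ∈ S, ∀ B ∈ S, ∀ C ∈ S, A ≠ B → A ≠ C → B ≠ C →
    ∀ R : Set (Submodule F V), IsRegulusThrough F n A B C R → R ⊆ S

section Slopes

variable {F K : Type*} [Field F] [Field K] [Algebra F K] {E : IntermediateField F K}
  {u v : K × K} {S : Set (Submodule F (K × K × F))} {A : Submodule F (K × K × F)}

/-- The affine coordinates, in the frame `u`, `v` of the line at infinity, of the members of `S`
other than the one through `v`. -/
def slopes (S : Set (Submodule F (K × K × F))) (u v : K × K) : Set K :=
  {t | spreadThrough F (u + t • v) ∈ S}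

variable (F) in
/-- The spread elements with affine coordinate in `T` in the frame `u`, `v`, together with the
one through `v`, whose coordinate is infinite. For a subfield `T` this is the image of a subline. -/
def ofSlopes (u v : K × K) (T : Set K) : Set (Submodule F (K × K × F)) :=
  insert (spreadThrough F v) ((fun t => spreadThrough F (u + t • v)) '' T)

theorem spreadThrough_smul_add_smul {s : K} (hs : s ≠ 0) (t : K) (u v : K × K) :
    spreadThrough F (s • u + t • v) = spreadThrough F (u + (s⁻¹ * t) • v) := by
  rw [← spreadThrough_smul hs (u + _), smul_add, smul_smul, mul_inv_cancel_left₀ hs]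

theorem ncard_ofSlopes (h : LinearIndependent K ![u, v]) {T : Set K} (hT : T.Finite) :
    (ofSlopes F u v T).ncard = T.ncard + 1 := by
  rw [ofSlopes, Set.ncard_insert_of_notMem _ (hT.image _), Set.ncard_image_of_injective]
  · intro s t hst
    by_contra hne
    exact spreadThrough_ne (linearIndependent_pair_add_smul_add_smul h hne) hst
  · rintro ⟨t, -, ht⟩
    exact spreadThrough_ne (by simpa using h) ht

theorem ofSlopes_slopes (h : LinearIndependent K ![u, v]) (hS : S ⊆ desarguesianSpread F K)
    (hv : spreadThrough F v ∈ S) : ofSlopes F u v (slopes S u v) = S := by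
  refine Set.Subset.antisymm ?_ fun A hA => ?_
  · exact Set.insert_subset hv (Set.image_subset_iff.2 fun _ => id)
  obtain ⟨w, hw, rfl⟩ := mem_desarguesianSpread.1 (hS hA)
  obtain ⟨s, t, rfl⟩ := Submodule.mem_span_pair.1
    (mem_span_pair_of_finrank_eq_two (by simp) h w)
  obtain rfl | hs := eq_or_ne s 0
  · rw [zero_smul, zero_add] at hw ⊢
    exact .inl (spreadThrough_smul (left_ne_zero_of_smul hw) v)
  · rw [spreadThrough_smul_add_smul hs] at hA ⊢
    exact .inr ⟨_, hA, rfl⟩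

theorem mem_ofSlopes_subfield_iff (h : LinearIndependent K ![u, v]) :
    A ∈ ofSlopes F u v E ↔
      ∃ s ∈ E, ∃ t ∈ E, s • u + t • v ≠ 0 ∧ A = spreadThrough F (s • u + t • v) := by
  constructor
  · rintro (rfl | ⟨t, ht, rfl⟩)
    · exact ⟨0, E.zero_mem, 1, E.one_mem, by simpa using h.ne_zero 1, by simp⟩
    · have hne := (linearIndependent_pair_add_smul_smul h t one_ne_zero).ne_zero 0
      exact ⟨1, E.one_mem, t, ht, by simpa using hne, by simp⟩
  · rintro ⟨s, hs, t, ht, hst, rfl⟩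
    obtain rfl | hs0 := eq_or_ne s 0
    · rw [zero_smul, zero_add] at hst ⊢
      exact .inl (spreadThrough_smul (left_ne_zero_of_smul hst) v)
    · rw [spreadThrough_smul_add_smul hs0]
      exact .inr ⟨s⁻¹ * t, E.mul_mem (E.inv_mem hs) ht, rfl⟩

theorem exists_inclInfinity_eq {w : K × K × F} (hw : w.2.2 = 0) :
    ∃ w' : K × K, inclInfinity F K w' = w :=
  ⟨(w.1, w.2.1), by rw [← Prod.mk.eta (p := w), ← Prod.mk.eta (p := w.2), hw]; rfl⟩

theorem linearIndependent_inclInfinity_iff :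
    LinearIndependent K ![inclInfinity K K u, inclInfinity K K v] ↔
      LinearIndependent K ![u, v] := by
  simp only [LinearIndependent.pair_iff, ← map_smul, ← map_add,
    map_eq_zero_iff _ inclInfinity_injective]

theorem mk_mem_lineInfinity_iff {w : K × K × K} (hw : w ≠ 0) :
    Projectivization.mk K w hw ∈ lineInfinity K ↔ w.2.2 = 0 := by
  rw [lineInfinity, Set.mem_ofPred_eq, Projectivization.submodule_mk]
  refine ⟨fun h => h w (Submodule.mem_span_singleton_self w), fun h p hp => ?_⟩
  obtain ⟨c, rfl⟩ := Submodule.mem_span_singleton.1 hp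
  simp [h]

theorem abbMap_mk_inclInfinity {w : K × K} (hw : inclInfinity K K w ≠ 0) :
    abbMap F (Projectivization.mk K (inclInfinity K K w) hw) = spreadThrough F w :=
  (abbMap_infinite w.1 w.2 hw).trans (spreadElement_top w)

theorem abbMap_image_subline (h : LinearIndependent K ![u, v]) :
    abbMap F '' {P | ∃ s ∈ E, ∃ t ∈ E, ∃ h : s • inclInfinity K K u + t • inclInfinity K K v ≠ 0,
      P = Projectivization.mk K (s • inclInfinity K K u + t • inclInfinity K K v) h} =
      ofSlopes F u v E := by
  ext A
  simp only [mem_ofSlopes_subfield_iff h, ← map_smul, ← map_add]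
  constructor
  · rintro ⟨_, ⟨s, hs, t, ht, hst, rfl⟩, rfl⟩
    exact ⟨s, hs, t, ht, ne_of_apply_ne (inclInfinity K K) (by rwa [map_zero]),
      abbMap_mk_inclInfinity hst⟩
  · rintro ⟨s, hs, t, ht, hst, rfl⟩
    have hst' := (map_ne_zero_iff _ (inclInfinity_injective (F := K))).2 hst
    exact ⟨_, ⟨s, hs, t, ht, hst', rfl⟩, abbMap_mk_inclInfinity hst'⟩

theorem exists_isSubline_iff :
    (∃ m, IsSubline E m ∧ m ⊆ lineInfinity K ∧ abbMap F '' m = S) ↔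
      ∃ u v : K × K, LinearIndependent K ![u, v] ∧ S = ofSlopes F u v E := by
  constructor
  · rintro ⟨_, ⟨u, v, h, rfl⟩, hm, rfl⟩
    have hu : u.2.2 = 0 := (mk_mem_lineInfinity_iff (h.ne_zero 0)).1
      (hm ⟨1, E.one_mem, 0, E.zero_mem, by simpa using h.ne_zero 0, by simp⟩)
    have hv : v.2.2 = 0 := (mk_mem_lineInfinity_iff (h.ne_zero 1)).1
      (hm ⟨0, E.zero_mem, 1, E.one_mem, by simpa using h.ne_zero 1, by simp⟩)
    obtain ⟨u, rfl⟩ := exists_inclInfinity_eq hu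
    obtain ⟨v, rfl⟩ := exists_inclInfinity_eq hv
    have h' := linearIndependent_inclInfinity_iff.1 h
    exact ⟨u, v, h', abbMap_image_subline h'⟩
  · rintro ⟨u, v, h, rfl⟩
    refine ⟨_, ⟨_, _, linearIndependent_inclInfinity_iff.2 h, rfl⟩, ?_, abbMap_image_subline h⟩
    rintro _ ⟨s, -, t, -, hst, rfl⟩
    rw [mk_mem_lineInfinity_iff, ← map_smul, ← map_smul, ← map_add]
    rfl

theorem spreadElement_le_hyperplaneInfinity (E : IntermediateField F K) (a b : K) :
    spreadElement E a b ≤ hyperplaneInfinity F K := by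
  rintro _ ⟨x, -, rfl⟩
  rfl

theorem spreadElement_add_smul_le_sup {t : K} (ht : t ∈ E) (u v : K × K) :
    spreadElement E (u + t • v).1 (u + t • v).2 ≤
      spreadElement E u.1 u.2 ⊔ spreadElement E v.1 v.2 := by
  rintro _ ⟨x, hx, rfl⟩
  refine Submodule.mem_sup.2 ⟨_, ⟨x, hx, rfl⟩, _, ⟨t * x, E.mul_mem ht hx, rfl⟩, ?_⟩
  simp only [Prod.mk_add_mk, Prod.fst_add, Prod.snd_add, Prod.smul_fst, Prod.smul_snd,
    smul_eq_mul, add_zero, Prod.mk.injEq, and_true]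
  constructor <;> ring

theorem spreadElement_add_smul_sup {t : K} (ht : t ∈ E) (u v : K × K) :
    spreadElement E (u + t • v).1 (u + t • v).2 ⊔ spreadElement E v.1 v.2 =
      spreadElement E u.1 u.2 ⊔ spreadElement E v.1 v.2 := by
  refine le_antisymm (sup_le (spreadElement_add_smul_le_sup ht u v) le_sup_right)
    (sup_le ?_ le_sup_right)
  have := spreadElement_add_smul_le_sup (E.neg_mem ht) (u + t • v) v
  rwa [neg_smul, add_neg_cancel_right] at this

theorem spreadThrough_inf_sup_spreadElement (E : IntermediateField F K)
    (h : LinearIndependent K ![u, v]) :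
    spreadThrough F u ⊓ (spreadElement E u.1 u.2 ⊔ spreadElement E v.1 v.2) =
      spreadElement E u.1 u.2 := by
  have hdisj := (disjoint_spreadThrough (F := F) h).mono_right (spreadElement_le_spreadThrough E v)
  rw [inf_comm, sup_inf_assoc_of_le _ (spreadElement_le_spreadThrough E u), inf_comm, hdisj.eq_bot,
    sup_bot_eq]

theorem finrank_sup_spreadElement [FiniteDimensional F K] (E : IntermediateField F K)
    (h : LinearIndependent K ![u, v]) :
    Module.finrank F (spreadElement E u.1 u.2 ⊔ spreadElement E v.1 v.2 :
      Submodule F (K × K × F)) = 2 * Module.finrank F E := by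
  have hdisj := (disjoint_spreadThrough (F := F) h).mono (spreadElement_le_spreadThrough E u)
    (spreadElement_le_spreadThrough E v)
  have hdim := Submodule.finrank_sup_add_finrank_inf_eq (spreadElement E u.1 u.2)
    (spreadElement E v.1 v.2)
  rwa [hdisj.eq_bot, finrank_bot, add_zero, finrank_spreadElement E (w := u) (h.ne_zero 0),
    finrank_spreadElement E (w := v) (h.ne_zero 1), ← two_mul] at hdim

theorem exists_inf_mem_subspread [FiniteDimensional F K] (E : IntermediateField F K)
    (h : LinearIndependent K ![u, v]) :
    ∃ W : Submodule F (K × K × F), W ≤ hyperplaneInfinity F K ∧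
      Module.finrank F W = 2 * Module.finrank F E ∧
      ∀ A ∈ ofSlopes F u v E, A ⊓ W ∈ subspread E := by
  refine ⟨spreadElement E u.1 u.2 ⊔ spreadElement E v.1 v.2,
    sup_le (spreadElement_le_hyperplaneInfinity ..) (spreadElement_le_hyperplaneInfinity ..),
    finrank_sup_spreadElement E h, ?_⟩
  rintro _ (rfl | ⟨t, ht, rfl⟩)
  · rw [sup_comm, spreadThrough_inf_sup_spreadElement E (LinearIndependent.pair_symm_iff.1 h)]
    exact ⟨_, _, h.ne_zero 1, rfl⟩
  · have ht' : LinearIndependent K ![u + t • v, v] := by simpa using h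
    rw [← spreadElement_add_smul_sup ht, spreadThrough_inf_sup_spreadElement E ht']
    exact ⟨_, _, ht'.ne_zero 0, rfl⟩

theorem isRegulusClosed_of_finrank_inf [Finite F] [FiniteDimensional F K] {k : ℕ} (hk : k ≠ 0)
    (hS : S ⊆ desarguesianSpread F K) (hcard : S.ncard = Nat.card F ^ k + 1)
    {W : Submodule F (K × K × F)} (hW : Module.finrank F W = 2 * k)
    (hSW : ∀ A ∈ S, Module.finrank F (A ⊓ W : Submodule F (K × K × F)) = k) :
    IsRegulusClosed F (Module.finrank F K) S := by
  intro A hA B hB C hC hAB hAC hBC R hR D hD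
  obtain ⟨u, v, h, rfl, rfl, rfl⟩ :=
    exists_frame_of_mem_desarguesianSpread (hS hA) (hS hB) (hS hC) hAB hAC hBC
  obtain rfl := (isRegulusThrough_spreadThrough_iff h).1 hR
  have hCW : spreadThrough F (u + v) ⊓ W ≠ ⊥ :=
    Submodule.one_le_finrank_iff.1 (by rw [hSW _ hC]; omega)
  have hsup : spreadThrough F u ⊓ W ⊔ spreadThrough F v ⊓ W = W :=
    inf_sup_inf_eq_of_finrank_le (disjoint_spreadThrough h) (by rw [hSW _ hA, hSW _ hB]; omega)
  rw [spreadThrough, map_add] at hCW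
  have hDW : D ⊓ W ≠ ⊥ :=
    inf_ne_bot_of_mem_pencil (injective_coprod_spreadMap (F := F) h) hsup.ge hCW hD
  obtain ⟨p, ⟨hpD, hpW⟩, hp0⟩ := Submodule.exists_mem_ne_zero_of_ne_bot hDW
  obtain ⟨⟨A', hA'⟩, hpA', -⟩ := exists_mem_of_pairwise_disjoint (A := fun A : S => A.1 ⊓ W)
    (fun A B hAB => (disjoint_of_mem_desarguesianSpread (hS A.2) (hS B.2)
      (Subtype.coe_ne_coe.2 hAB)).mono inf_le_left inf_le_left)
    (fun _ => inf_le_right) (fun A => hSW A A.2) hcard hW hpW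
  obtain rfl | hDA' := eq_or_ne D A'
  · exact hA'
  · exact absurd (Submodule.disjoint_def.1 (disjoint_of_mem_desarguesianSpread
      (pencil_spreadMap_subset u v hD) (hS hA') hDA') p hpD hpA') hp0

theorem inv_mem_slopes (hv : spreadThrough F v ∈ S) {t : K} (ht : t ∈ slopes S u v) :
    t⁻¹ ∈ slopes S v u := by
  obtain rfl | ht0 := eq_or_ne t 0
  · simpa [slopes] using hv
  · rw [slopes, Set.mem_ofPred_eq, ← spreadThrough_smul ht0, smul_add, smul_inv_smul₀ ht0, add_comm]
    exact ht

namespace IsRegulusClosed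

theorem spreadThrough_add_smul_mem [Finite F] [FiniteDimensional F K]
    (hS : IsRegulusClosed F (Module.finrank F K) S) (h : LinearIndependent K ![u, v])
    (hu : spreadThrough F u ∈ S) (hv : spreadThrough F v ∈ S) (huv : spreadThrough F (u + v) ∈ S)
    (r : F) : spreadThrough F (u + r • v) ∈ S := by
  refine hS _ hu _ hv _ huv (spreadThrough_ne h) (spreadThrough_ne (by simpa using h))
    (spreadThrough_ne ?_) _ ((isRegulusThrough_spreadThrough_iff h).2 rfl) ?_
  · rw [add_comm]
    simpa using LinearIndependent.pair_symm_iff.1 h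
  · have hli := linearIndependent_of_injective_coprod (injective_coprod_spreadMap (F := F) h)
    rw [mem_pencil_iff hli, spreadThrough, map_add, map_smul]
    exact .inr ⟨r, rfl⟩

theorem lineMap_mem_slopes [Finite F] [FiniteDimensional F K]
    (hS : IsRegulusClosed F (Module.finrank F K) S) (h : LinearIndependent K ![u, v])
    (hv : spreadThrough F v ∈ S) {a b : K} (ha : a ∈ slopes S u v) (hb : b ∈ slopes S u v)
    (r : F) : AffineMap.lineMap a b r ∈ slopes S u v := by
  obtain rfl | hab := eq_or_ne a b
  · rwa [AffineMap.lineMap_same_apply]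
  have hba := sub_ne_zero.2 hab.symm
  have hmem := hS.spreadThrough_add_smul_mem (linearIndependent_pair_add_smul_smul h a hba) ha
    (by rwa [spreadThrough_smul hba]) (by rwa [add_assoc, ← add_smul, add_sub_cancel]) r
  rwa [← smul_assoc, add_assoc, ← add_smul, add_comm a, ← AffineMap.lineMap_apply_module'] at hmem

theorem exists_submodule_coe_eq_slopes [Finite F] [FiniteDimensional F K]
    (hS : IsRegulusClosed F (Module.finrank F K) S) (hF : 2 < Nat.card F)
    (h : LinearIndependent K ![u, v]) (hu : spreadThrough F u ∈ S) (hv : spreadThrough F v ∈ S) :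
    ∃ p : Submodule F K, (p : Set K) = slopes S u v := by
  obtain ⟨c, hc⟩ : ∃ c : F, c ∉ ({0, 1} : Set F) := by
    by_contra! hall
    have := Set.ncard_insert_le (0 : F) {1}
    rw [Set.eq_univ_of_forall hall, Set.ncard_univ, Set.ncard_singleton] at this
    omega
  rw [Set.mem_insert_iff, Set.mem_singleton_iff, not_or] at hc
  exact exists_submodule_coe_eq_of_lineMap_mem hc.1 hc.2 (by simpa [slopes] using hu)
    fun a ha b hb r => hS.lineMap_mem_slopes h hv ha hb r

theorem exists_subfield_coe_eq_slopes [Finite F] [FiniteDimensional F K]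
    (hS : IsRegulusClosed F (Module.finrank F K) S) (hF : 2 < Nat.card F)
    (h : LinearIndependent K ![u, v]) (hu : spreadThrough F u ∈ S) (hv : spreadThrough F v ∈ S)
    (huv : spreadThrough F (u + v) ∈ S) : ∃ L : Subfield K, (L : Set K) = slopes S u v := by
  have : Finite K := Module.finite_of_finite F
  obtain ⟨p, hp⟩ := hS.exists_submodule_coe_eq_slopes hF h hu hv
  obtain ⟨p', hp'⟩ := hS.exists_submodule_coe_eq_slopes hF (LinearIndependent.pair_symm_iff.1 h)
    hv hu
  have hinv {x : K} (hx : x ∈ p) : x⁻¹ ∈ p' := hp'.ge (inv_mem_slopes hv (hp.le hx))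
  have hinv' {x : K} (hx : x ∈ p') : x⁻¹ ∈ p := hp.ge (inv_mem_slopes hu (hp'.le hx))
  have hharm : IsHarmonic p.toAddSubgroup := fun x hx y hy =>
    hinv' (p'.add_mem (hinv hx) (hinv hy))
  obtain ⟨L, hL⟩ := hharm.exists_subfield_coe_eq (hp.ge (by simpa [slopes] using huv))
  exact ⟨L, hL.trans hp⟩

theorem exists_eq_ofSlopes [Finite F] [FiniteDimensional F K]
    (hS : IsRegulusClosed F (Module.finrank F K) S) (hF : 2 < Nat.card F)
    (hSD : S ⊆ desarguesianSpread F K) (hcard : S.ncard = Nat.card E + 1) :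
    ∃ u v : K × K, LinearIndependent K ![u, v] ∧ S = ofSlopes F u v E := by
  have : Finite K := Module.finite_of_finite F
  have : 1 < Nat.card E := Finite.one_lt_card
  obtain ⟨A, B, C, hA, hB, hC, hAB, hAC, hBC⟩ :=
    (Set.two_lt_ncard_iff (Set.finite_of_ncard_ne_zero (s := S) (by omega))).1 (by omega)
  obtain ⟨u, v, h, rfl, rfl, rfl⟩ :=
    exists_frame_of_mem_desarguesianSpread (hSD hA) (hSD hB) (hSD hC) hAB hAC hBC
  obtain ⟨L, hL⟩ := hS.exists_subfield_coe_eq_slopes hF h hA hB hC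
  have hSL : ofSlopes F u v L = S := hL ▸ ofSlopes_slopes h hSD hB
  have hLE : Nat.card L = Nat.card E.toSubfield :=
    Nat.add_right_cancel ((ncard_ofSlopes h (Set.toFinite (L : Set K))).symm.trans
      ((congrArg Set.ncard hSL).trans hcard))
  rw [subfield_eq_of_natCard_eq hLE] at hSL
  exact ⟨u, v, h, hSL.symm⟩

end IsRegulusClosed

end Slopes

end ABB

theorem theorem2p10 {F K : Type*} [Field F] [Finite F] [Field K] [Finite K] [Algebra F K]
    (q n k : ℕ) (hq : Nat.card F = q) (hq2 : 2 < q) (hn : Module.finrank F K = n)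
    (E : IntermediateField F K) (hE : Module.finrank F E = k)
    (S : Set (Submodule F (K × K × F))) (hS : S ⊆ ABB.desarguesianSpread F K)
    (hcard : S.ncard = q ^ k + 1) :
    -- any three elements of the spread lie in a unique regulus
    (∀ A ∈ ABB.desarguesianSpread F K, ∀ B ∈ ABB.desarguesianSpread F K,
      ∀ C ∈ ABB.desarguesianSpread F K, A ≠ B → A ≠ C → B ≠ C →
        ∃! R : Set (Submodule F (K × K × F)), ABB.IsRegulusThrough F n A B C R) ∧
    List.TFAE [
      -- (1)
      ∃ m : Set (ℙ K (K × K × K)), ABB.IsSubline E m ∧ m ⊆ ABB.lineInfinity K ∧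
        ABB.abbMap F '' m = S,
      -- (2)
      ∀ A ∈ S, ∀ B ∈ S, ∀ C ∈ S, A ≠ B → A ≠ C → B ≠ C →
        ∀ R : Set (Submodule F (K × K × F)), ABB.IsRegulusThrough F n A B C R → R ⊆ S,
      -- (3)
      ∃ W : Submodule F (K × K × F), W ≤ ABB.hyperplaneInfinity F K ∧
        Module.finrank F W = 2 * k ∧
        ∀ A ∈ S, Module.finrank F (A ⊓ W : Submodule F (K × K × F)) = k,
      -- (4)
      ∃ W : Submodule F (K × K × F), W ≤ ABB.hyperplaneInfinity F K ∧
        Module.finrank F W = 2 * k ∧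
        ∀ A ∈ S, A ⊓ W ∈ ABB.subspread E] := by
  subst hq hn hE
  refine ⟨fun A hA B hB C hC => ABB.existsUnique_isRegulusThrough hA hB hC, ?_⟩
  rw [ABB.exists_isSubline_iff]
  tfae_have 1 → 4 := by
    rintro ⟨u, v, h, rfl⟩
    exact ABB.exists_inf_mem_subspread E h
  tfae_have 4 → 3 := fun ⟨W, hW, hWrank, hSW⟩ =>
    ⟨W, hW, hWrank, fun A hA => ABB.finrank_of_mem_subspread (hSW A hA)⟩
  tfae_have 3 → 2 := fun ⟨W, _, hWrank, hSW⟩ =>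
    ABB.isRegulusClosed_of_finrank_inf Module.finrank_pos.ne' hS hcard hWrank hSW
  tfae_have 2 → 1 := fun hclosed =>
    ABB.IsRegulusClosed.exists_eq_ofSlopes hclosed hq2 hS
      (hcard.trans (congrArg (· + 1) Module.natCard_eq_pow_finrank.symm))
  tfae_finish
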